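/- Write $\|\cdot\|_2$ for the spectral norm, $\|\cdot\|_F$ for the Frobenius norm, $\mathbb{O}_{d,r}$ for the set of real $d\times r$ matrices with orthonormal columns, $\mathbb{O}_r=\mathbb{O}_{r,r}$, and $\mathrm{dist}(U,W)=\|(I-UU^{\mathsf T})W\|_2$ for $U,W\in\mathbb{O}_{d,r}$. There is a universal constant $C>0$ such that the following holds. Let $1\le r<d$ and let $A\in\mathbb{R}^{d\times d}$ be symmetric with eigenvalues $\lambda_1(A)\ge\dots\ge\lambda_d(A)$, eigengap $\delta_r(A)=\lambda_r(A)-\lambda_{r+1}(A)$, and $\delta_r(A)\ge\delta>0$. Let $\alpha\in(0,1/2)$ and let $\mathcal I_{\mathsf{bad}}\subset[m]$ satisfy $|\mathcal I_{\mathsf{bad}}|/m\le\alpha$. Every node $i\in\mathcal I_{\mathsf{good}}=[m]\setminus\mathcal I_{\mathsf{bad}}$ observes a symmetric matrix $A_i\in\mathbb{R}^{d\times d}$ with $\|A_i-A\|_2\le\delta_r(A)/8$ and responds with a matrix $\widehat V_i=V_i\in\mathbb{O}_{d,r}$ whose columns span the principal $r$-dimensional eigenspace of $A_i$; every node $i\in\mathcal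 I_{\mathsf{bad}}$ responds with an arbitrary $\widehat V_i\in\mathbb{O}_{d,r}$. Let $\widehat V_{\mathsf{ref}}=\widehat V_{i_\star}$ be the robust reference, where $i_\star$ minimizes over $i\in[m]$ the radius $\varepsilon_i=\min\{\rho\ge 0 : |\{j\in[m]:\mathrm{dist}(\widehat V_i,\widehat V_j)\le\rho\}|>m/2\}$. Let $V\in\mathbb{O}_{d,r}$ be a matrix whose columns span the principal $r$-dimensional eigenspace of $A$, chosen to be aligned with the reference, i.e. $\|V-\widehat V_{\mathsf{ref}}\|_F=\min_{Z\in\mathbb{O}_r}\|VZ-\widehat V_{\mathsf{ref}}\|_F$, and suppose that $\mathrm{dist}(V,\widehat V_{\mathsf{ref}})=\varepsilon<\delta_r(A)/8$. Let $S\subset\mathcal I_{\mathsf{good}}$ be a nonempty index set and, for $i\in S$, let $V_i^{\mathsf{corr}}=V_iZ_i$ where $Z_i$ is any minimizer of $\|V_iZ-\widehat V_{\mathsf{ref}}\|_F$ over $Z\in\mathbb{O}_r$. Then $$\Bigl\|\frac1{|S|}\sum_{i\in S}V_i^{\mathsf{corr}}-V\Bigr\|_2\le C\Bigl(\frac1{\delta^2|S|}\sum_{i\in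 S}\max\bigl(\|A_i-A\|_2^2,\ \|A\|_2^2\varepsilon^2\bigr)+\frac1\delta\Bigl\|\frac1{|S|}\sum_{i\in S}A_i-A\Bigr\|_2\Bigr).$$ -/

import Mathlib

namespace DistributedEigenspace

section Norms

open scoped Matrix.Norms.L2Operator

/-- The spectral norm (`ℓ₂ → ℓ₂` operator norm) of a real matrix. -/
noncomputable def specNorm {n k : ℕ} (M : Matrix (Fin n) (Fin k) ℝ) : ℝ := ‖M‖

end Norms

open Matrix

/-- The Frobenius norm of a real matrix, the square root of `⟨M, M⟩ = tr (Mᵀ M)`. -/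
noncomputable def frobNorm {n k : ℕ} (M : Matrix (Fin n) (Fin k) ℝ) : ℝ :=
  Real.sqrt (Mᵀ * M).trace

/-- `V` has orthonormal columns. -/
def OrthonormalCols {d r : ℕ} (V : Matrix (Fin d) (Fin r) ℝ) : Prop := Vᵀ * V = 1

/-- The subspace distance `‖(I - U Uᵀ) V‖₂` of two matrices with orthonormal columns. -/
noncomputable def subspaceDist {d r : ℕ} (U V : Matrix (Fin d) (Fin r) ℝ) : ℝ :=
  specNorm ((1 - U * Uᵀ) * V)

/-- The eigenvalues of a real symmetric matrix in nonincreasing order, with multiplicity,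
counted from zero: `sortedEigenvalue hA k` is the `(k + 1)`-st largest one. -/
noncomputable def sortedEigenvalue {d : ℕ} {A : Matrix (Fin d) (Fin d) ℝ}
    (hA : A.IsHermitian) (k : Fin d) : ℝ :=
  hA.eigenvalues₀ (Fin.cast (Fintype.card_fin d).symm k)

/-- The eigengap between the `r`-th and the `(r + 1)`-st largest eigenvalue, `1 ≤ r < d`. -/
noncomputable def eigengap {d r : ℕ} {A : Matrix (Fin d) (Fin d) ℝ}
    (hA : A.IsHermitian) (hr : 0 < r) (hrd : r < d) : ℝ :=
  sortedEigenvalue hA ⟨r - 1, by omega⟩ - sortedEigenvalue hA ⟨r, hrd⟩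

/-- `V` has orthonormal columns, and they span the principal `r`-dimensional eigenspace of the
symmetric matrix `A`: the span of the first `r` columns of `Q` in a spectral decomposition
`A = Q diag(μ) Qᵀ` with nonincreasing eigenvalues `μ`. -/
def SpansPrincipal {d r : ℕ} (A : Matrix (Fin d) (Fin d) ℝ) (V : Matrix (Fin d) (Fin r) ℝ) :
    Prop :=
  OrthonormalCols V ∧
    ∃ Q ∈ Matrix.orthogonalGroup (Fin d) ℝ, ∃ μ : Fin d → ℝ,
      Antitone μ ∧ A = Q * Matrix.diagonal μ * Qᵀ ∧
        Submodule.span ℝ (Set.range V.col) = Submodule.span ℝ (Q.col '' {k | (k : ℕ) < r})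

/-- `Z` minimizes `‖Y Z - W‖_F` over the orthogonal `r × r` matrices. -/
def IsProcrustesSolution {d r : ℕ} (Y W : Matrix (Fin d) (Fin r) ℝ)
    (Z : Matrix (Fin r) (Fin r) ℝ) : Prop :=
  Z ∈ Matrix.orthogonalGroup (Fin r) ℝ ∧
    ∀ Z' ∈ Matrix.orthogonalGroup (Fin r) ℝ, frobNorm (Y * Z - W) ≤ frobNorm (Y * Z' - W)

/-- The least radius `ρ ≥ 0` such that more than half of the responses `Y j` are within
distance `ρ` of `Y i`. -/
noncomputable def majorityRadius {d r m : ℕ} (Y : Fin m → Matrix (Fin d) (Fin r) ℝ)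
    (i : Fin m) : ℝ :=
  sInf {ρ : ℝ | 0 ≤ ρ ∧ (m : ℝ) / 2 < Set.ncard {j : Fin m | subspaceDist (Y i) (Y j) ≤ ρ}}

/-- `W` is an output of the robust reference estimator on `Y 1, …, Y m`: a response whose
majority radius is minimal. -/
def IsRobustReference {d r m : ℕ} (Y : Fin m → Matrix (Fin d) (Fin r) ℝ)
    (W : Matrix (Fin d) (Fin r) ℝ) : Prop :=
  ∃ i : Fin m, (∀ j, majorityRadius Y i ≤ majorityRadius Y j) ∧ W = Y i

/-- The corruption model: at most a fraction `α ∈ (0, 1/2)` of the `m` nodes is bad. Every good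
node `i` observes a symmetric matrix `B i` and responds with an orthonormal basis `Y i` of its
principal `r`-dimensional eigenspace; a bad node responds with an arbitrary matrix with
orthonormal columns (nothing is said about `B i` then). -/
structure CorruptionModel {d r m : ℕ} (α : ℝ) (bad : Finset (Fin m))
    (B : Fin m → Matrix (Fin d) (Fin d) ℝ) (Y : Fin m → Matrix (Fin d) (Fin r) ℝ) : Prop where
  pos : 0 < α
  lt_half : α < 1 / 2
  card_bad : (bad.card : ℝ) / m ≤ α
  good_symm : ∀ i ∉ bad, (B i).IsHermitian
  good_response : ∀ i ∉ bad, SpansPrincipal (B i) (Y i)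
  bad_response : ∀ i ∈ bad, OrthonormalCols (Y i)

end DistributedEigenspace

open DistributedEigenspace

/-! Let `W` be one aligned response, `E` its error `B i - A`, `g` the eigengap, `U` the reference
and `P = 1 - V Vᵀ`. To first order `W - V` is linear in `E`, so it can be averaged before it is
estimated; all other terms are quadratic. With `K = Vᵀ W` and `T = P W`, the rescaled basis `W K⁻¹ =
V + X`, `X = T K⁻¹`, satisfies `A X - X (Vᵀ A V) = R - P E V` with `‖R‖ = O(‖E‖² / g)`
(`exists_first_order_expansion`). The Sylvester operator on the left is the same for all nodes and
is bounded below by `g` where `Vᵀ X = 0` (`gap_mul_norm_le_of_sylvester`). Applied to the mean of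
the `X`, it gives the mean of `‖R‖ / g` plus the norm of the mean error over `g`.

There remains `W - V - X = W K⁻¹ (K - 1)`, which is small only if `K` is the identity to second
order. This is the role of the alignment: Procrustes optimality makes `Vᵀ U` and `Wᵀ U` symmetric
and positive semidefinite (`IsProcrustesSolution.symm_and_nonneg`). Such an `H` satisfies `‖1 - H‖ ≤
‖1 - H²‖`, and the right side is a squared subspace distance. With `davis_kahan`,
`norm_transpose_mul_sub_one_le` then gives `‖K - 1‖ = O(ε² + (‖E‖ / g)²)`. The term `ε²` is absorbed
by the maximum because `δ ≤ g ≤ 2 ‖A‖`. -/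

namespace DistributedEigenspace

open Matrix
open scoped Matrix.Norms.L2Operator

/-! ### Spectral norm, singular vectors and the Sylvester lower bound. -/

section Norm

variable {n k : ℕ}

theorem dotProduct_self_eq_norm_sq (x : Fin n → ℝ) : x ⬝ᵥ x = ‖WithLp.toLp 2 x‖ ^ 2 := by
  rw [EuclideanSpace.norm_sq_eq]
  simp [dotProduct, sq]

theorem dotProduct_self_nonneg' (x : Fin n → ℝ) : 0 ≤ x ⬝ᵥ x := by
  rw [dotProduct_self_eq_norm_sq]; positivity

theorem abs_dotProduct_le (x y : Fin n → ℝ) :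
    |x ⬝ᵥ y| ≤ ‖WithLp.toLp 2 x‖ * ‖WithLp.toLp 2 y‖ := by
  have h := abs_real_inner_le_norm (WithLp.toLp 2 y) (WithLp.toLp 2 x)
  rw [EuclideanSpace.inner_eq_star_dotProduct] at h
  simpa [mul_comm] using h

theorem norm_toLp_mulVec_le (M : Matrix (Fin n) (Fin k) ℝ) (x : Fin k → ℝ) :
    ‖WithLp.toLp 2 (M *ᵥ x)‖ ≤ ‖M‖ * ‖WithLp.toLp 2 x‖ :=
  l2_opNorm_mulVec M (WithLp.toLp 2 x)

theorem dotProduct_mulVec_self_le (M : Matrix (Fin n) (Fin k) ℝ) (x : Fin k → ℝ) :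
    (M *ᵥ x) ⬝ᵥ (M *ᵥ x) ≤ ‖M‖ ^ 2 * (x ⬝ᵥ x) := by
  rw [dotProduct_self_eq_norm_sq, dotProduct_self_eq_norm_sq, ← mul_pow]
  exact pow_le_pow_left₀ (norm_nonneg _) (norm_toLp_mulVec_le M x) 2

theorem abs_dotProduct_mulVec_le (M : Matrix (Fin n) (Fin n) ℝ) (x : Fin n → ℝ) :
    |x ⬝ᵥ (M *ᵥ x)| ≤ ‖M‖ * (x ⬝ᵥ x) := by
  rw [dotProduct_self_eq_norm_sq]
  refine (abs_dotProduct_le _ _).trans ?_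
  have := mul_le_mul_of_nonneg_left (norm_toLp_mulVec_le M x) (norm_nonneg (WithLp.toLp 2 x))
  linarith

theorem norm_le_of_mulVec_bound (M : Matrix (Fin n) (Fin k) ℝ) {c : ℝ} (hc : 0 ≤ c)
    (h : ∀ x, (M *ᵥ x) ⬝ᵥ (M *ᵥ x) ≤ c ^ 2 * (x ⬝ᵥ x)) : ‖M‖ ≤ c := by
  rw [l2_opNorm_def]
  refine ContinuousLinearMap.opNorm_le_bound _ hc fun x => ?_
  have h' := h x.ofLp
  rw [dotProduct_self_eq_norm_sq, dotProduct_self_eq_norm_sq, ← mul_pow] at h'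
  exact le_of_sq_le_sq h' (by positivity)

theorem norm_transpose (M : Matrix (Fin n) (Fin k) ℝ) : ‖Mᵀ‖ = ‖M‖ := by
  rw [← conjTranspose_eq_transpose_of_trivial, l2_opNorm_conjTranspose]

theorem norm_transpose_mul_self (M : Matrix (Fin n) (Fin k) ℝ) : ‖Mᵀ * M‖ = ‖M‖ ^ 2 := by
  rw [← conjTranspose_eq_transpose_of_trivial, l2_opNorm_conjTranspose_mul_self, sq]

theorem dotProduct_mulVec_comm (M : Matrix (Fin n) (Fin k) ℝ) (x : Fin n → ℝ) (y : Fin k → ℝ) :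
    x ⬝ᵥ (M *ᵥ y) = (Mᵀ *ᵥ x) ⬝ᵥ y := by
  rw [dotProduct_mulVec, mulVec_transpose]

theorem norm_le_one_of_orthonormalCols {V : Matrix (Fin n) (Fin k) ℝ} (hV : OrthonormalCols V) :
    ‖V‖ ≤ 1 := by
  refine norm_le_of_mulVec_bound V zero_le_one fun x => ?_
  rw [dotProduct_mulVec_comm, mulVec_mulVec, hV, one_mulVec]
  simp

/-- A top right singular vector of a matrix. -/
theorem exists_top_singular_vector (M : Matrix (Fin n) (Fin k) ℝ) (hM : M ≠ 0) :
    ∃ v : Fin k → ℝ, v ⬝ᵥ v = 1 ∧ Mᵀ *ᵥ (M *ᵥ v) = ‖M‖ ^ 2 • v := by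
  have hs : 0 < ‖M‖ := norm_pos_iff.mpr hM
  obtain ⟨x, hx, hmax⟩ := (isCompact_closedBall (0 : EuclideanSpace ℝ (Fin k)) 1).exists_isMaxOn
    ⟨0, by simp⟩ (f := fun x => ‖WithLp.toLp 2 (M *ᵥ x.ofLp)‖)
    (Continuous.continuousOn (by fun_prop))
  have hx1 : ‖x‖ ≤ 1 := by simpa using hx
  have hle : ‖M‖ ≤ ‖WithLp.toLp 2 (M *ᵥ x.ofLp)‖ := by
    rw [l2_opNorm_def]
    refine ContinuousLinearMap.opNorm_le_bound _ (norm_nonneg _) fun y => ?_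
    rcases eq_or_ne y 0 with rfl | hy
    · simp
    · have hy' : 0 < ‖y‖ := norm_pos_iff.mpr hy
      have := hmax (a := ‖y‖⁻¹ • y) (by simp [norm_smul, hy'.ne'])
      simp only [Set.mem_ofPred_eq, WithLp.ofLp_smul, mulVec_smul, WithLp.toLp_smul, norm_smul,
        norm_inv, norm_norm] at this
      rw [inv_mul_le_iff₀ hy', mul_comm] at this
      exact this
  have hub := norm_toLp_mulVec_le M x.ofLp
  have hxn : ‖x‖ = 1 := by
    refine le_antisymm hx1 ?_
    have : ‖M‖ * 1 ≤ ‖M‖ * ‖x‖ := by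
      rw [mul_one]; exact hle.trans hub
    exact le_of_mul_le_mul_left this hs
  have hnorm : ‖WithLp.toLp 2 (M *ᵥ x.ofLp)‖ = ‖M‖ := by
    refine le_antisymm ?_ hle
    have h2 : ‖WithLp.toLp 2 x.ofLp‖ = 1 := hxn
    rw [h2, mul_one] at hub
    exact hub
  have hxx : x.ofLp ⬝ᵥ x.ofLp = 1 := by
    rw [dotProduct_self_eq_norm_sq]
    have h2 : ‖WithLp.toLp 2 x.ofLp‖ = 1 := hxn
    rw [h2, one_pow]
  refine ⟨x.ofLp, hxx, ?_⟩
  set u := M *ᵥ x.ofLp with hu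
  have huu : u ⬝ᵥ u = ‖M‖ ^ 2 := by rw [dotProduct_self_eq_norm_sq, hnorm]
  have h1 : (Mᵀ *ᵥ u) ⬝ᵥ (Mᵀ *ᵥ u) ≤ ‖M‖ ^ 2 * ‖M‖ ^ 2 := by
    have := dotProduct_mulVec_self_le Mᵀ u
    rwa [norm_transpose, huu] at this
  have h2 : (Mᵀ *ᵥ u) ⬝ᵥ x.ofLp = ‖M‖ ^ 2 := by
    rw [← dotProduct_mulVec_comm, ← hu, huu]
  -- The equality case of Cauchy–Schwarz replaces a Lagrange multiplier: the squared distance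
  -- expands to at most `‖M‖⁴ - 2 ‖M‖⁴ + ‖M‖⁴ = 0`.
  have h3 : (Mᵀ *ᵥ u - ‖M‖ ^ 2 • x.ofLp) ⬝ᵥ (Mᵀ *ᵥ u - ‖M‖ ^ 2 • x.ofLp) ≤ 0 := by
    have e : (Mᵀ *ᵥ u - ‖M‖ ^ 2 • x.ofLp) ⬝ᵥ (Mᵀ *ᵥ u - ‖M‖ ^ 2 • x.ofLp)
        = (Mᵀ *ᵥ u) ⬝ᵥ (Mᵀ *ᵥ u) - 2 * ‖M‖ ^ 2 * ((Mᵀ *ᵥ u) ⬝ᵥ x.ofLp)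
          + ‖M‖ ^ 2 * ‖M‖ ^ 2 * (x.ofLp ⬝ᵥ x.ofLp) := by
      rw [sub_dotProduct, dotProduct_sub, dotProduct_sub, dotProduct_smul, smul_dotProduct,
        smul_dotProduct, dotProduct_smul, dotProduct_comm x.ofLp]
      simp only [smul_eq_mul]
      ring
    rw [e, h2, hxx]
    nlinarith
  have h4 := dotProduct_self_eq_zero.mp (le_antisymm h3 (dotProduct_self_nonneg' _))
  exact sub_eq_zero.mp h4

/-- A Sylvester operator `Y ↦ A Y - Y Λ` is bounded below by the gap between the quadratic forms of
`A`, on the range of `Y`, and of `Λ`. -/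
theorem gap_mul_norm_le_of_sylvester {A : Matrix (Fin n) (Fin n) ℝ} {Λ : Matrix (Fin k) (Fin k) ℝ}
    {Y R : Matrix (Fin n) (Fin k) ℝ} {a b : ℝ} (hR : A * Y - Y * Λ = R)
    (hA : ∀ v, (Y *ᵥ v) ⬝ᵥ (A *ᵥ (Y *ᵥ v)) ≤ b * ((Y *ᵥ v) ⬝ᵥ (Y *ᵥ v)))
    (hΛ : ∀ v, a * (v ⬝ᵥ v) ≤ v ⬝ᵥ (Λ *ᵥ v)) :
    (a - b) * ‖Y‖ ≤ ‖R‖ := by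
  rcases eq_or_ne Y 0 with rfl | hY
  · simp
  have hs : 0 < ‖Y‖ := norm_pos_iff.mpr hY
  obtain ⟨v, hv, hYv⟩ := exists_top_singular_vector Y hY
  set u := Y *ᵥ v with hu
  have huu : u ⬝ᵥ u = ‖Y‖ ^ 2 := by
    conv_lhs => rw [hu]
    rw [dotProduct_mulVec_comm, ← hu, hYv, smul_dotProduct, hv, smul_eq_mul, mul_one]
  have hun : ‖WithLp.toLp 2 u‖ = ‖Y‖ := by
    rw [dotProduct_self_eq_norm_sq] at huu
    exact (sq_eq_sq₀ (norm_nonneg _) (norm_nonneg _)).mp huu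
  have hvn : ‖WithLp.toLp 2 v‖ = 1 := by
    rw [dotProduct_self_eq_norm_sq] at hv
    exact (sq_eq_sq₀ (norm_nonneg _) zero_le_one).mp (by rw [hv, one_pow])
  -- Pairing the equation with the top singular pair turns `Y Λ` into a quadratic form of `Λ`, since
  -- `Yᵀ u = ‖Y‖² v`.
  have h1 : u ⬝ᵥ (R *ᵥ v) = u ⬝ᵥ (A *ᵥ u) - ‖Y‖ ^ 2 * (v ⬝ᵥ (Λ *ᵥ v)) := by
    rw [← hR, sub_mulVec, dotProduct_sub, ← mulVec_mulVec, ← mulVec_mulVec, ← hu,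
      dotProduct_mulVec_comm Y u, hYv, smul_dotProduct, smul_eq_mul]
  have h2 := hA v
  have h3 := hΛ v
  rw [← hu, huu] at h2
  rw [hv, mul_one] at h3
  have h4 : |u ⬝ᵥ (R *ᵥ v)| ≤ ‖Y‖ * ‖R‖ := by
    refine (abs_dotProduct_le _ _).trans ?_
    rw [hun]
    refine mul_le_mul_of_nonneg_left ?_ hs.le
    have := norm_toLp_mulVec_le R v
    rwa [hvn, mul_one] at this
  have h5 : ‖Y‖ ^ 2 * a ≤ ‖Y‖ ^ 2 * (v ⬝ᵥ (Λ *ᵥ v)) :=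
    mul_le_mul_of_nonneg_left h3 (by positivity)
  have h6 := (abs_le.mp h4).1
  refine le_of_mul_le_mul_left ?_ hs
  nlinarith

/-- If `H` is symmetric and positive semidefinite, then `‖1 - H‖ ≤ ‖1 - H ^ 2‖`. -/
theorem norm_one_sub_le_of_symm_nonneg {H : Matrix (Fin n) (Fin n) ℝ}
    (hpos : ∀ x, 0 ≤ x ⬝ᵥ (H *ᵥ x)) : ‖1 - H‖ ≤ ‖1 - H * H‖ := by
  refine norm_le_of_mulVec_bound _ (norm_nonneg _) fun x => ?_
  refine le_trans ?_ (dotProduct_mulVec_self_le (1 - H * H) x)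
  -- For `y = (1 - H) x` this reads `(1 - H²) x = y + H y`, and the cross term `y ⬝ᵥ H y` is
  -- nonnegative.
  have e : (1 - H * H) *ᵥ x = (1 - H) *ᵥ x + H *ᵥ ((1 - H) *ᵥ x) := by
    rw [mulVec_mulVec, ← add_mulVec]
    congr 1
    noncomm_ring
  rw [e, add_dotProduct, dotProduct_add, dotProduct_add]
  have h1 := hpos ((1 - H) *ᵥ x)
  have h2 := dotProduct_self_nonneg' (H *ᵥ ((1 - H) *ᵥ x))
  rw [dotProduct_comm (H *ᵥ ((1 - H) *ᵥ x)) ((1 - H) *ᵥ x)]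
  linarith

end Norm

/-! ### Sorted eigenvalues, Weyl's inequality and principal eigenspaces. -/

section Spectral

variable {d r : ℕ}

theorem dotProduct_mulVec_of_spectral {A Q : Matrix (Fin d) (Fin d) ℝ} {μ : Fin d → ℝ}
    (hA : A = Q * diagonal μ * Qᵀ) (x : Fin d → ℝ) :
    x ⬝ᵥ (A *ᵥ x) = ∑ j, μ j * (Qᵀ *ᵥ x) j ^ 2 := by
  rw [hA, ← mulVec_mulVec, ← mulVec_mulVec, dotProduct_mulVec_comm]
  simp only [dotProduct, mulVec_diagonal]
  exact Finset.sum_congr rfl fun j _ => by ring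

theorem dotProduct_self_of_orthogonal {Q : Matrix (Fin d) (Fin d) ℝ}
    (hQ : Q ∈ orthogonalGroup (Fin d) ℝ) (x : Fin d → ℝ) :
    x ⬝ᵥ x = ∑ j, (Qᵀ *ᵥ x) j ^ 2 := by
  have h : x ⬝ᵥ x = (Qᵀ *ᵥ x) ⬝ᵥ (Qᵀ *ᵥ x) := by
    rw [dotProduct_mulVec_comm Qᵀ, mulVec_mulVec, transpose_transpose,
      (mem_orthogonalGroup_iff _ _).mp hQ, one_mulVec]
  rw [h]
  simp [dotProduct, sq]

/-- Weyl's inequality for eigenvalues in nonincreasing order. -/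
theorem eigenvalue_le_add_norm_sub {A B Q R : Matrix (Fin d) (Fin d) ℝ} {μ ν : Fin d → ℝ}
    (hQ : Q ∈ orthogonalGroup (Fin d) ℝ) (hR : R ∈ orthogonalGroup (Fin d) ℝ)
    (hμ : Antitone μ) (hν : Antitone ν) (hA : A = Q * diagonal μ * Qᵀ)
    (hB : B = R * diagonal ν * Rᵀ) (k : Fin d) : μ k ≤ ν k + ‖A - B‖ := by
  classical
  -- Row `k` is zero, so `M` has a nonzero kernel vector: it lies in the span of the columns of `Q`
  -- up to `k` and in that of the columns of `R` from `k` on. This is the dimension count of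
  -- Courant–Fischer.
  let M : Matrix (Fin d) (Fin d) ℝ := of fun j =>
    if k < j then Qᵀ j else if j < k then Rᵀ j else 0
  obtain ⟨x, hx0, hx⟩ := exists_mulVec_eq_zero_iff.mpr
    (det_eq_zero_of_row_eq_zero (A := M) k (fun j => by simp [M]))
  have hQx : ∀ j, k < j → (Qᵀ *ᵥ x) j = 0 := fun j hj => by
    have := congrFun hx j
    simpa [M, mulVec, hj] using this
  have hRx : ∀ j, j < k → (Rᵀ *ᵥ x) j = 0 := fun j hj => by
    have := congrFun hx j
    simpa [M, mulVec, hj, hj.le, not_lt.mpr hj.le] using this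
  have hxx : 0 < x ⬝ᵥ x := by
    refine lt_of_le_of_ne (dotProduct_self_nonneg' x) fun h => hx0 ?_
    exact dotProduct_self_eq_zero.mp h.symm
  have h1 : μ k * (x ⬝ᵥ x) ≤ x ⬝ᵥ (A *ᵥ x) := by
    rw [dotProduct_mulVec_of_spectral hA, dotProduct_self_of_orthogonal hQ, Finset.mul_sum]
    refine Finset.sum_le_sum fun j _ => ?_
    rcases lt_or_ge k j with h | h
    · simp [hQx j h]
    · exact mul_le_mul_of_nonneg_right (hμ h) (sq_nonneg _)
  have h2 : x ⬝ᵥ (B *ᵥ x) ≤ ν k * (x ⬝ᵥ x) := by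
    rw [dotProduct_mulVec_of_spectral hB, dotProduct_self_of_orthogonal hR, Finset.mul_sum]
    refine Finset.sum_le_sum fun j _ => ?_
    rcases lt_or_ge j k with h | h
    · simp [hRx j h]
    · exact mul_le_mul_of_nonneg_right (hν h) (sq_nonneg _)
  have h3 := (abs_le.mp (abs_dotProduct_mulVec_le (A - B) x)).2
  rw [sub_mulVec, dotProduct_sub] at h3
  refine le_of_mul_le_mul_right ?_ hxx
  linarith

theorem exists_spectral_sortedEigenvalue {A : Matrix (Fin d) (Fin d) ℝ} (hA : A.IsHermitian) :
    ∃ Q ∈ orthogonalGroup (Fin d) ℝ,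
      A = Q * diagonal (sortedEigenvalue hA) * Qᵀ ∧ Antitone (sortedEigenvalue hA) := by
  let U : Matrix (Fin d) (Fin d) ℝ := hA.eigenvectorUnitary
  have hU : U * Uᵀ = 1 := (mem_orthogonalGroup_iff _ _).mp hA.eigenvectorUnitary.2
  -- `eigenvalues` lists `eigenvalues₀` along an arbitrary identification of index types; permuting
  -- the eigenvectors by `σ` restores the sorted order.
  let σ : Fin d ≃ Fin d := (finCongr (Fintype.card_fin d).symm).trans
    (Fintype.equivOfCardEq (Fintype.card_fin _))
  have hσ : sortedEigenvalue hA = hA.eigenvalues ∘ σ := by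
    funext k
    simp [sortedEigenvalue, IsHermitian.eigenvalues, σ]
  have hspec : A = U * diagonal hA.eigenvalues * Uᵀ := by
    have := hA.spectral_theorem
    rw [Unitary.conjStarAlgAut_apply] at this
    simpa [U, star_eq_conjTranspose] using! this
  refine ⟨U.submatrix id σ, ?_, ?_, ?_⟩
  · rw [mem_orthogonalGroup_iff, transpose_submatrix, submatrix_mul_equiv, hU, submatrix_one]
    exact Function.injective_id
  · rw [hσ, transpose_submatrix]
    have : diagonal (hA.eigenvalues ∘ σ) = (diagonal hA.eigenvalues).submatrix σ σ := by
      rw [submatrix_diagonal_equiv]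
    rw [this, submatrix_mul_equiv, submatrix_mul_equiv, submatrix_id_id]
    exact hspec
  · intro i j hij
    exact hA.eigenvalues₀_antitone (by simpa using hij)

/-- Weyl's inequality at distance zero, in both directions. It ties the arbitrary decomposition
inside `SpansPrincipal` to the eigenvalues that define the gap. -/
theorem eq_sortedEigenvalue_of_spectral {A Q : Matrix (Fin d) (Fin d) ℝ} (hA : A.IsHermitian)
    {μ : Fin d → ℝ} (hQ : Q ∈ orthogonalGroup (Fin d) ℝ) (hμ : Antitone μ)
    (h : A = Q * diagonal μ * Qᵀ) : μ = sortedEigenvalue hA := by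
  obtain ⟨R, hR, hAR, hanti⟩ := exists_spectral_sortedEigenvalue hA
  funext k
  have h1 := eigenvalue_le_add_norm_sub hQ hR hμ hanti h hAR k
  have h2 := eigenvalue_le_add_norm_sub hR hQ hanti hμ hAR h k
  rw [sub_self, norm_zero, add_zero] at h1 h2
  exact le_antisymm h1 h2

theorem sortedEigenvalue_le_add_norm_sub {A B : Matrix (Fin d) (Fin d) ℝ} (hA : A.IsHermitian)
    (hB : B.IsHermitian) (k : Fin d) :
    sortedEigenvalue hA k ≤ sortedEigenvalue hB k + ‖A - B‖ := by
  obtain ⟨Q, hQ, hAQ, hanti⟩ := exists_spectral_sortedEigenvalue hA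
  obtain ⟨R, hR, hBR, hanti'⟩ := exists_spectral_sortedEigenvalue hB
  exact eigenvalue_le_add_norm_sub hQ hR hanti hanti' hAQ hBR k

theorem abs_sortedEigenvalue_le_norm {A : Matrix (Fin d) (Fin d) ℝ} (hA : A.IsHermitian)
    (k : Fin d) : |sortedEigenvalue hA k| ≤ ‖A‖ := by
  have h0 : (0 : Matrix (Fin d) (Fin d) ℝ).IsHermitian := isHermitian_zero
  have hz : sortedEigenvalue h0 k = 0 := by
    have := eq_sortedEigenvalue_of_spectral h0 (μ := fun _ => 0)
      (one_mem (orthogonalGroup (Fin d) ℝ)) antitone_const (by simp)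
    exact (congrFun this k).symm
  have h1 := sortedEigenvalue_le_add_norm_sub hA h0 k
  have h2 := sortedEigenvalue_le_add_norm_sub h0 hA k
  rw [hz] at h1 h2
  rw [sub_zero] at h1
  rw [zero_sub, norm_neg] at h2
  exact abs_le.mpr ⟨by linarith, by linarith⟩

theorem eigengap_le_two_mul_norm {A : Matrix (Fin d) (Fin d) ℝ} (hA : A.IsHermitian) (hr : 0 < r)
    (hrd : r < d) : eigengap hA hr hrd ≤ 2 * ‖A‖ := by
  have h1 := (abs_le.mp (abs_sortedEigenvalue_le_norm hA ⟨r - 1, by omega⟩)).2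
  have h2 := (abs_le.mp (abs_sortedEigenvalue_le_norm hA ⟨r, hrd⟩)).1
  unfold eigengap
  linarith

/-- Both sides are symmetric projections, and each fixes the range of the other: `J V = V`
transposes to `Vᵀ J = Vᵀ`, which turns `V Vᵀ J = J` into the claim. -/
theorem mul_transpose_eq_of_span_eq {V : Matrix (Fin d) (Fin r) ℝ} {Q : Matrix (Fin d) (Fin d) ℝ}
    (hV : OrthonormalCols V) (hQ : Q ∈ orthogonalGroup (Fin d) ℝ)
    (h : Submodule.span ℝ (Set.range V.col) = Submodule.span ℝ (Q.col '' {k | (k : ℕ) < r})) :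
    V * Vᵀ = Q * diagonal (fun k : Fin d => if (k : ℕ) < r then (1 : ℝ) else 0) * Qᵀ := by
  set J := Q * diagonal (fun k : Fin d => if (k : ℕ) < r then (1 : ℝ) else 0) * Qᵀ with hJ
  have hQQ : Qᵀ * Q = 1 := (mem_orthogonalGroup_iff' _ _).mp hQ
  have hJQ : ∀ k : Fin d, (k : ℕ) < r → J *ᵥ Q.col k = Q.col k := fun k hk => by
    have e : J * Q = Q * diagonal (fun k : Fin d => if (k : ℕ) < r then (1 : ℝ) else 0) := by
      rw [hJ, Matrix.mul_assoc, hQQ, Matrix.mul_one]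
    funext i
    have := congrFun (congrFun e i) k
    rw [mul_diagonal] at this
    simpa [hk, mul_apply, mulVec, dotProduct, col] using this
  have hVV : ∀ k, (V * Vᵀ) *ᵥ V.col k = V.col k := fun k => by
    have e : V * Vᵀ * V = V := by
      rw [Matrix.mul_assoc, hV, Matrix.mul_one]
    funext i
    have := congrFun (congrFun e i) k
    simpa [mul_apply, mulVec, dotProduct, col] using this
  have hJfix : ∀ x ∈ Submodule.span ℝ (Set.range V.col), J *ᵥ x = x := fun x hx => by
    rw [h] at hx
    induction hx using Submodule.span_induction with
    | mem x hx => obtain ⟨k, hk, rfl⟩ := hx; exact hJQ k hk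
    | zero => simp
    | add x y _ _ hx hy => rw [mulVec_add, hx, hy]
    | smul c x _ hx => rw [mulVec_smul, hx]
  have hVfix : ∀ x ∈ Submodule.span ℝ (Q.col '' {k | (k : ℕ) < r}), (V * Vᵀ) *ᵥ x = x :=
    fun x hx => by
      rw [← h] at hx
      induction hx using Submodule.span_induction with
      | mem x hx => obtain ⟨k, rfl⟩ := hx; exact hVV k
      | zero => simp
      | add x y _ _ hx hy => rw [mulVec_add, hx, hy]
      | smul c x _ hx => rw [mulVec_smul, hx]
  have h1 : J * V = V := by
    ext i k
    have := congrFun (hJfix (V.col k) (Submodule.subset_span ⟨k, rfl⟩)) i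
    simpa [mul_apply, mulVec, dotProduct, col] using this
  have h2 : V * Vᵀ * Q * diagonal (fun k : Fin d => if (k : ℕ) < r then (1 : ℝ) else 0)
      = Q * diagonal (fun k : Fin d => if (k : ℕ) < r then (1 : ℝ) else 0) := by
    ext i k
    rw [mul_diagonal, mul_diagonal]
    split_ifs with hk
    · have := congrFun (hVfix (Q.col k) (Submodule.subset_span ⟨k, hk, rfl⟩)) i
      simpa [mul_apply, mulVec, dotProduct, col] using this
    · simp
  have h3 : V * Vᵀ * J = J := by
    rw [hJ, ← Matrix.mul_assoc, ← Matrix.mul_assoc, h2]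
  have hJt : Jᵀ = J := by
    rw [hJ, transpose_mul, transpose_mul, transpose_transpose, diagonal_transpose,
      Matrix.mul_assoc]
  have h4 : Vᵀ * J = Vᵀ := by
    rw [← hJt, ← transpose_mul, h1]
  rw [Matrix.mul_assoc, h4] at h3
  exact h3

/-- An orthonormal basis of the principal eigenspace spans an invariant subspace; the quadratic
form of the matrix is bounded below on it and above on its orthogonal complement. -/
theorem SpansPrincipal.spectral_bounds {A : Matrix (Fin d) (Fin d) ℝ} (hA : A.IsHermitian)
    (hr : 0 < r) (hrd : r < d) {V : Matrix (Fin d) (Fin r) ℝ} (h : SpansPrincipal A V) :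
    V * Vᵀ * A = A * (V * Vᵀ) ∧
      (∀ x, sortedEigenvalue hA ⟨r - 1, by omega⟩ * (x ⬝ᵥ x) ≤ x ⬝ᵥ ((Vᵀ * A * V) *ᵥ x)) ∧
      ∀ x, Vᵀ *ᵥ x = 0 → x ⬝ᵥ (A *ᵥ x) ≤ sortedEigenvalue hA ⟨r, hrd⟩ * (x ⬝ᵥ x) := by
  obtain ⟨hV, Q, hQ, μ, hμ, hAQ, hspan⟩ := h
  have hP := mul_transpose_eq_of_span_eq hV hQ hspan
  have hQQ : Qᵀ * Q = 1 := (mem_orthogonalGroup_iff' _ _).mp hQ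
  rw [← eq_sortedEigenvalue_of_spectral hA hQ hμ hAQ]
  have hproj : ∀ x, Qᵀ *ᵥ ((V * Vᵀ) *ᵥ x)
      = diagonal (fun k : Fin d => if (k : ℕ) < r then (1 : ℝ) else 0) *ᵥ (Qᵀ *ᵥ x) := fun x => by
    rw [hP, mulVec_mulVec, ← Matrix.mul_assoc, ← Matrix.mul_assoc, hQQ, Matrix.one_mul,
      mulVec_mulVec]
  refine ⟨?_, fun x => ?_, fun x hx => ?_⟩
  · have e : ∀ D₁ D₂ : Matrix (Fin d) (Fin d) ℝ,
        Q * D₁ * Qᵀ * (Q * D₂ * Qᵀ) = Q * (D₁ * D₂) * Qᵀ := fun D₁ D₂ => by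
      calc Q * D₁ * Qᵀ * (Q * D₂ * Qᵀ) = Q * D₁ * (Qᵀ * Q) * D₂ * Qᵀ := by
            simp only [Matrix.mul_assoc]
        _ = _ := by rw [hQQ, Matrix.mul_one, Matrix.mul_assoc Q]
    rw [hP, hAQ, e, e, diagonal_mul_diagonal, diagonal_mul_diagonal]
    simp only [mul_comm]
  · have hzero : ∀ j : Fin d, ¬ (j : ℕ) < r → (Qᵀ *ᵥ (V *ᵥ x)) j = 0 := fun j hj => by
      have e : (V * Vᵀ) *ᵥ (V *ᵥ x) = V *ᵥ x := by
        rw [mulVec_mulVec, Matrix.mul_assoc, hV, Matrix.mul_one]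
      have := congrFun (hproj (V *ᵥ x)) j
      rw [e, mulVec_diagonal, if_neg hj, zero_mul] at this
      exact this
    have hxx : x ⬝ᵥ x = (V *ᵥ x) ⬝ᵥ (V *ᵥ x) := by
      rw [dotProduct_mulVec_comm V, mulVec_mulVec, hV, one_mulVec]
    have hxA : x ⬝ᵥ ((Vᵀ * A * V) *ᵥ x) = (V *ᵥ x) ⬝ᵥ (A *ᵥ (V *ᵥ x)) := by
      rw [← mulVec_mulVec, ← mulVec_mulVec, dotProduct_mulVec_comm Vᵀ, transpose_transpose]
    rw [hxA, hxx, dotProduct_mulVec_of_spectral hAQ, dotProduct_self_of_orthogonal hQ,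
      Finset.mul_sum]
    refine Finset.sum_le_sum fun j _ => ?_
    by_cases hj : (j : ℕ) < r
    · exact mul_le_mul_of_nonneg_right
        (hμ (Fin.le_def.mpr (show (j : ℕ) ≤ r - 1 by omega))) (sq_nonneg _)
    · simp [hzero j hj]
  · have hzero : ∀ j : Fin d, (j : ℕ) < r → (Qᵀ *ᵥ x) j = 0 := fun j hj => by
      have := congrFun (hproj x) j
      rw [← mulVec_mulVec, hx, mulVec_zero, mulVec_zero, mulVec_diagonal, if_pos hj,
        one_mul] at this
      exact this.symm
    rw [dotProduct_mulVec_of_spectral hAQ, dotProduct_self_of_orthogonal hQ, Finset.mul_sum]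
    refine Finset.sum_le_sum fun j _ => ?_
    by_cases hj : (j : ℕ) < r
    · simp [hzero j hj]
    · exact mul_le_mul_of_nonneg_right
        (hμ (Fin.le_def.mpr (show r ≤ (j : ℕ) by omega))) (sq_nonneg _)

end Spectral

/-! ### Optimality conditions of the Procrustes problem. -/

section Procrustes

variable {d r : ℕ}

theorem householder_mul_householder (a b : ℝ) (u w : Fin r → ℝ) :
    (1 - a • vecMulVec u u) * (1 - b • vecMulVec w w)
      = 1 - a • vecMulVec u u - b • vecMulVec w w + (a * b * (u ⬝ᵥ w)) • vecMulVec u w := by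
  simp only [Matrix.mul_sub, Matrix.sub_mul, Matrix.mul_one, Matrix.one_mul, smul_mul_smul_comm,
    vecMulVec_mul_vecMulVec, vecMulVec_smul, smul_smul]
  abel

/-- Reflections and products of two of them are enough test matrices for Procrustes optimality; no
polar or singular value decomposition is needed. -/
theorem householder_mem_orthogonalGroup {u : Fin r → ℝ} (hu : u ≠ 0) :
    1 - (2 / (u ⬝ᵥ u)) • vecMulVec u u ∈ orthogonalGroup (Fin r) ℝ := by
  have hu' : u ⬝ᵥ u ≠ 0 := fun h => hu (dotProduct_self_eq_zero.mp h)
  rw [mem_orthogonalGroup_iff, transpose_sub, transpose_smul, transpose_vecMulVec, transpose_one,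
    householder_mul_householder]
  have : 2 / (u ⬝ᵥ u) * (2 / (u ⬝ᵥ u)) * (u ⬝ᵥ u) = 2 / (u ⬝ᵥ u) + 2 / (u ⬝ᵥ u) := by
    field_simp
    ring
  rw [this, add_smul]
  abel

theorem trace_vecMulVec_mul (u w : Fin r → ℝ) (H : Matrix (Fin r) (Fin r) ℝ) :
    (vecMulVec u w * H).trace = w ⬝ᵥ (H *ᵥ u) := by
  rw [vecMulVec_mul, trace_vecMulVec, dotProduct_comm, dotProduct_mulVec]

/-- A matrix whose trace cannot be increased by orthogonal factors is symmetric and positive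
semidefinite. -/
theorem symm_and_nonneg_of_trace_mul_le {H : Matrix (Fin r) (Fin r) ℝ}
    (h : ∀ O ∈ orthogonalGroup (Fin r) ℝ, (O * H).trace ≤ H.trace) :
    Hᵀ = H ∧ ∀ x, 0 ≤ x ⬝ᵥ (H *ᵥ x) := by
  have hpos : ∀ x, 0 ≤ x ⬝ᵥ (H *ᵥ x) := fun x => by
    rcases eq_or_ne x 0 with rfl | hx
    · simp
    have hxx : 0 < x ⬝ᵥ x := lt_of_le_of_ne (dotProduct_self_nonneg' x)
      fun h => hx (dotProduct_self_eq_zero.mp h.symm)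
    have := h _ (householder_mem_orthogonalGroup hx)
    rw [Matrix.sub_mul, Matrix.one_mul, trace_sub, smul_mul, trace_smul, trace_vecMulVec_mul,
      smul_eq_mul] at this
    have h2 : 0 ≤ 2 / (x ⬝ᵥ x) * (x ⬝ᵥ (H *ᵥ x)) := by linarith
    exact nonneg_of_mul_nonneg_right h2 (by positivity)
  have hpair : ∀ u w : Fin r → ℝ, u ≠ 0 → w ≠ 0 →
      2 * (u ⬝ᵥ w) * (w ⬝ᵥ (H *ᵥ u)) ≤
        (w ⬝ᵥ w) * (u ⬝ᵥ (H *ᵥ u)) + (u ⬝ᵥ u) * (w ⬝ᵥ (H *ᵥ w)) := fun u w hu hw => by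
    have huu : 0 < u ⬝ᵥ u := lt_of_le_of_ne (dotProduct_self_nonneg' u)
      fun h => hu (dotProduct_self_eq_zero.mp h.symm)
    have hww : 0 < w ⬝ᵥ w := lt_of_le_of_ne (dotProduct_self_nonneg' w)
      fun h => hw (dotProduct_self_eq_zero.mp h.symm)
    have := h _ (mul_mem (householder_mem_orthogonalGroup hu) (householder_mem_orthogonalGroup hw))
    rw [householder_mul_householder, Matrix.add_mul, Matrix.sub_mul, Matrix.sub_mul,
      Matrix.one_mul, trace_add, trace_sub, trace_sub, smul_mul, smul_mul, smul_mul,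
      trace_smul, trace_smul, trace_smul, trace_vecMulVec_mul, trace_vecMulVec_mul,
      trace_vecMulVec_mul] at this
    simp only [smul_eq_mul] at this
    have e : (w ⬝ᵥ w) * (u ⬝ᵥ (H *ᵥ u)) + (u ⬝ᵥ u) * (w ⬝ᵥ (H *ᵥ w))
        - 2 * (u ⬝ᵥ w) * (w ⬝ᵥ (H *ᵥ u))
        = (u ⬝ᵥ u) * (w ⬝ᵥ w) / 2 * (2 / (u ⬝ᵥ u) * (u ⬝ᵥ (H *ᵥ u))
          + 2 / (w ⬝ᵥ w) * (w ⬝ᵥ (H *ᵥ w))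
          - 2 / (u ⬝ᵥ u) * (2 / (w ⬝ᵥ w)) * (u ⬝ᵥ w) * (w ⬝ᵥ (H *ᵥ u))) := by
      field_simp
    have h2 : 0 ≤ (u ⬝ᵥ u) * (w ⬝ᵥ w) / 2 * (2 / (u ⬝ᵥ u) * (u ⬝ᵥ (H *ᵥ u))
          + 2 / (w ⬝ᵥ w) * (w ⬝ᵥ (H *ᵥ w))
          - 2 / (u ⬝ᵥ u) * (2 / (w ⬝ᵥ w)) * (u ⬝ᵥ w) * (w ⬝ᵥ (H *ᵥ u))) :=
      mul_nonneg (by positivity) (by linarith)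
    linarith
  refine ⟨?_, hpos⟩
  ext a b
  rw [transpose_apply]
  rcases eq_or_ne a b with rfl | hab
  · rfl
  -- The pair `u = e_a`, `w = e_a + s e_b` gives a rotation in a coordinate plane. As the inequality
  -- holds for both signs of `s`, the linear coefficient must vanish.
  have hquad : ∀ s : ℝ, 0 ≤ s * (H a b - H b a) + s ^ 2 * (H a a + H b b) := fun s => by
    have hu : (Pi.single a 1 : Fin r → ℝ) ≠ 0 := by simp
    have hw : (Pi.single a 1 + s • Pi.single b 1 : Fin r → ℝ) ≠ 0 := fun h0 => by
      have := congrFun h0 a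
      simp [hab] at this
    have := hpair _ _ hu hw
    simp only [mulVec_add, mulVec_smul, add_dotProduct, dotProduct_add, smul_dotProduct,
      dotProduct_smul, single_one_dotProduct, mulVec_single_one, Matrix.col_apply, smul_eq_mul,
      Pi.single_eq_same, Pi.single_eq_of_ne hab, Pi.single_eq_of_ne hab.symm] at this
    nlinarith
  have haa : 0 ≤ H a a := by simpa using hpos (Pi.single a 1)
  have hbb : 0 ≤ H b b := by simpa using hpos (Pi.single b 1)
  have hT : 0 < H a a + H b b + 1 := by linarith
  -- The `+ 1` in the denominator keeps this choice of `s` meaningful when both diagonal entries are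
  -- zero.
  have h1 := hquad (-(H a b - H b a) / (H a a + H b b + 1))
  have h2 : -(H a b - H b a) / (H a a + H b b + 1) * (H a b - H b a)
      + (-(H a b - H b a) / (H a a + H b b + 1)) ^ 2 * (H a a + H b b)
      = -((H a b - H b a) / (H a a + H b b + 1)) ^ 2 := by
    field_simp
    ring
  rw [h2] at h1
  have h3 : (H a b - H b a) / (H a a + H b b + 1) = 0 :=
    pow_eq_zero_iff two_ne_zero |>.mp (le_antisymm (by linarith) (sq_nonneg _))
  have h4 := (div_eq_zero_iff.mp h3).resolve_right hT.ne'
  linarith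

theorem OrthonormalCols.mul_orthogonal {Y : Matrix (Fin d) (Fin r) ℝ} (hY : OrthonormalCols Y)
    {Z : Matrix (Fin r) (Fin r) ℝ} (hZ : Z ∈ orthogonalGroup (Fin r) ℝ) :
    OrthonormalCols (Y * Z) := by
  unfold OrthonormalCols at *
  rw [transpose_mul, Matrix.mul_assoc, ← Matrix.mul_assoc Yᵀ, hY, Matrix.one_mul,
    (mem_orthogonalGroup_iff' _ _).mp hZ]

/-- The cross Gram matrix of a Procrustes-aligned pair is symmetric and positive semidefinite. -/
theorem IsProcrustesSolution.symm_and_nonneg {Y U : Matrix (Fin d) (Fin r) ℝ}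
    (hY : OrthonormalCols Y) {Z : Matrix (Fin r) (Fin r) ℝ} (h : IsProcrustesSolution Y U Z) :
    ((Y * Z)ᵀ * U)ᵀ = (Y * Z)ᵀ * U ∧ ∀ x, 0 ≤ x ⬝ᵥ (((Y * Z)ᵀ * U) *ᵥ x) := by
  refine symm_and_nonneg_of_trace_mul_le fun O hO => ?_
  have hO' : Oᵀ ∈ orthogonalGroup (Fin r) ℝ := by
    rw [mem_orthogonalGroup_iff, transpose_transpose]
    exact (mem_orthogonalGroup_iff' _ _).mp hO
  -- The competitor `Z Oᵀ` changes `H = (Y Z)ᵀ U` into `O H`. All other terms of the squared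
  -- Frobenius distance are constant, so minimality says that `H` has the largest trace.
  have hZO := mul_mem h.1 hO'
  have key := h.2 _ hZO
  unfold frobNorm at key
  have expand : ∀ W : Matrix (Fin d) (Fin r) ℝ, OrthonormalCols W →
      ((W - U)ᵀ * (W - U)).trace
        = (1 : Matrix (Fin r) (Fin r) ℝ).trace + (Uᵀ * U).trace - 2 * (Wᵀ * U).trace := by
    intro W hW
    have e : (Uᵀ * W).trace = (Wᵀ * U).trace := by
      rw [← trace_transpose, transpose_mul, transpose_transpose]
    rw [transpose_sub, Matrix.sub_mul, Matrix.mul_sub, Matrix.mul_sub, hW, trace_sub, trace_sub,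
      trace_sub, e]
    ring
  have hnn : 0 ≤ ((Y * (Z * Oᵀ) - U)ᵀ * (Y * (Z * Oᵀ) - U)).trace := by
    rw [trace]
    refine Finset.sum_nonneg fun i _ => ?_
    rw [diag_apply, mul_apply]
    exact Finset.sum_nonneg fun j _ => mul_self_nonneg _
  rw [Real.sqrt_le_sqrt_iff hnn, expand _ (hY.mul_orthogonal h.1), expand _ (hY.mul_orthogonal hZO),
    ← Matrix.mul_assoc, transpose_mul (Y * Z), transpose_transpose, Matrix.mul_assoc O] at key
  linarith

end Procrustes

/-! ### Second-order alignment through a common reference. -/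

section Alignment

variable {d r : ℕ}

theorem norm_one_sub_mul_transpose_le {V : Matrix (Fin d) (Fin r) ℝ} (hV : OrthonormalCols V) :
    ‖1 - V * Vᵀ‖ ≤ 1 := by
  refine norm_le_of_mulVec_bound _ zero_le_one fun x => ?_
  have e : (V *ᵥ (Vᵀ *ᵥ x)) ⬝ᵥ (V *ᵥ (Vᵀ *ᵥ x)) = (Vᵀ *ᵥ x) ⬝ᵥ (Vᵀ *ᵥ x) := by
    rw [dotProduct_mulVec_comm V, mulVec_mulVec (Vᵀ *ᵥ x), hV, one_mulVec]
  rw [sub_mulVec, one_mulVec, ← mulVec_mulVec, sub_dotProduct, dotProduct_sub, dotProduct_sub, e,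
    dotProduct_comm (V *ᵥ _) x, dotProduct_mulVec_comm V x]
  have := dotProduct_self_nonneg' (Vᵀ *ᵥ x)
  linarith

theorem complement_gram {V : Matrix (Fin d) (Fin r) ℝ} (hV : OrthonormalCols V)
    (W U : Matrix (Fin d) (Fin r) ℝ) :
    ((1 - V * Vᵀ) * W)ᵀ * ((1 - V * Vᵀ) * U) = Wᵀ * U - (Vᵀ * W)ᵀ * (Vᵀ * U) := by
  have hP : (1 - V * Vᵀ)ᵀ * (1 - V * Vᵀ) = 1 - V * Vᵀ := by
    rw [transpose_sub, transpose_mul, transpose_transpose, transpose_one, Matrix.mul_sub,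
      Matrix.mul_one, Matrix.sub_mul, Matrix.one_mul, Matrix.mul_assoc V, ← Matrix.mul_assoc Vᵀ,
      hV, Matrix.one_mul, sub_self, sub_zero]
  rw [transpose_mul, Matrix.mul_assoc, ← Matrix.mul_assoc (1 - V * Vᵀ)ᵀ, hP, Matrix.sub_mul,
    Matrix.one_mul, Matrix.mul_sub, transpose_mul, transpose_transpose]
  simp only [Matrix.mul_assoc]

/-- The matrix form of `1 - cos² = sin²` for principal angles; it makes alignment errors quadratic
in subspace distances. -/
theorem norm_one_sub_gram {V U : Matrix (Fin d) (Fin r) ℝ} (hV : OrthonormalCols V)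
    (hU : OrthonormalCols U) :
    ‖1 - (Vᵀ * U)ᵀ * (Vᵀ * U)‖ = ‖(1 - V * Vᵀ) * U‖ ^ 2 := by
  rw [← norm_transpose_mul_self, complement_gram hV, hU]

theorem norm_transpose_mul_le_one {V U : Matrix (Fin d) (Fin r) ℝ} (hV : OrthonormalCols V)
    (hU : OrthonormalCols U) : ‖Vᵀ * U‖ ≤ 1 := by
  refine (l2_opNorm_mul _ _).trans ?_
  rw [norm_transpose]
  exact mul_le_one₀ (norm_le_one_of_orthonormalCols hV) (norm_nonneg _)
    (norm_le_one_of_orthonormalCols hU)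

/-- Two orthonormal frames that are aligned with the same reference are aligned with each other
to second order. -/
theorem norm_transpose_mul_sub_one_le {V W U : Matrix (Fin d) (Fin r) ℝ} (hV : OrthonormalCols V)
    (hW : OrthonormalCols W) (hU : OrthonormalCols U) (hVU : (Vᵀ * U)ᵀ = Vᵀ * U)
    (hVU' : ∀ x, 0 ≤ x ⬝ᵥ ((Vᵀ * U) *ᵥ x)) (hWU : (Wᵀ * U)ᵀ = Wᵀ * U)
    (hWU' : ∀ x, 0 ≤ x ⬝ᵥ ((Wᵀ * U) *ᵥ x)) :
    ‖Vᵀ * W - 1‖ ≤ 4 * (‖(1 - V * Vᵀ) * U‖ ^ 2 + ‖(1 - V * Vᵀ) * W‖ ^ 2) := by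
  set N := (1 - V * Vᵀ) * U with hN
  set T := (1 - V * Vᵀ) * W with hT
  have hM : ‖1 - Vᵀ * U‖ ≤ ‖N‖ ^ 2 := by
    refine (norm_one_sub_le_of_symm_nonneg hVU').trans ?_
    rw [hN, ← norm_one_sub_gram hV hU, hVU]
  -- Symmetry of `Vᵀ U` gives `Uᵀ V = Vᵀ U`, so both distances have the same cosine matrix.
  have hsymm : ‖(1 - U * Uᵀ) * V‖ = ‖N‖ := by
    have h1 := norm_one_sub_gram hV hU
    have h2 := norm_one_sub_gram hU hV
    have e : Uᵀ * V = Vᵀ * U := by rw [← hVU, transpose_mul, transpose_transpose]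
    rw [e] at h2
    exact (sq_eq_sq₀ (norm_nonneg _) (norm_nonneg _)).mp (h2.symm.trans h1)
  -- A triangle inequality for subspace distances, from the splitting `W = V Vᵀ W + T`.
  have hWdist : ‖(1 - U * Uᵀ) * W‖ ≤ ‖N‖ + ‖T‖ := by
    have e : (1 - U * Uᵀ) * W = (1 - U * Uᵀ) * V * (Vᵀ * W) + (1 - U * Uᵀ) * T := by
      rw [hT, Matrix.sub_mul 1 (V * Vᵀ), Matrix.one_mul, Matrix.mul_sub]
      simp only [Matrix.mul_assoc]
      abel
    rw [e]
    refine (norm_add_le _ _).trans (add_le_add ?_ ?_)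
    · refine (l2_opNorm_mul _ _).trans ?_
      rw [hsymm]
      exact mul_le_of_le_one_right (norm_nonneg _) (norm_transpose_mul_le_one hV hW)
    · refine (l2_opNorm_mul _ _).trans ?_
      exact mul_le_of_le_one_left (norm_nonneg _) (norm_one_sub_mul_transpose_le hU)
  have hH : ‖1 - Wᵀ * U‖ ≤ (‖N‖ + ‖T‖) ^ 2 := by
    refine (norm_one_sub_le_of_symm_nonneg hWU').trans ?_
    have e : (Uᵀ * W) = Wᵀ * U := by rw [← hWU, transpose_mul, transpose_transpose]
    have h1 := norm_one_sub_gram hU hW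
    rw [e, hWU] at h1
    rw [h1]
    exact pow_le_pow_left₀ (norm_nonneg _) hWdist 2
  have hdecomp : (Vᵀ * W - 1)ᵀ
      = -(1 - Wᵀ * U) + (Wᵀ * V) * (1 - Vᵀ * U) - Tᵀ * N := by
    rw [hT, hN, complement_gram hV, transpose_sub, transpose_mul, transpose_transpose,
      transpose_one, Matrix.mul_sub, Matrix.mul_one]
    abel
  rw [← norm_transpose, hdecomp]
  have h1 : ‖(Wᵀ * V) * (1 - Vᵀ * U)‖ ≤ ‖N‖ ^ 2 :=
    ((norm_mul_le _ _).trans (mul_le_of_le_one_left (norm_nonneg _)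
      (norm_transpose_mul_le_one hW hV))).trans hM
  have h2 : ‖Tᵀ * N‖ ≤ ‖T‖ * ‖N‖ := by
    rw [← norm_transpose T]
    exact l2_opNorm_mul _ _
  refine (norm_sub_le _ _).trans ?_
  have h3 := norm_add_le (-(1 - Wᵀ * U)) ((Wᵀ * V) * (1 - Vᵀ * U))
  rw [norm_neg] at h3
  -- The three terms add up to `(‖N‖ + ‖T‖)² + ‖N‖² + ‖T‖ ‖N‖`.
  nlinarith [sq_nonneg (‖N‖ - ‖T‖)]

end Alignment

/-! ### Davis–Kahan bound and first-order expansion of one response. -/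

section Perturbation

variable {d r : ℕ}

/-- Multiplying the Gram identity by the inverse gives `G = Kᵀ + T G`, hence `‖G‖ ≤ 1 + ‖G‖ / 2`. -/
theorem norm_le_two_of_inverse {K G T : Matrix (Fin r) (Fin r) ℝ} (hG : K * G = 1)
    (hK : ‖K‖ ≤ 1) (hT : ‖T‖ ≤ 1 / 2) (h : Kᵀ * K = 1 - T) : ‖G‖ ≤ 2 := by
  have e : G = Kᵀ + T * G := by
    have : Kᵀ * K * G = G - T * G := by rw [h, Matrix.sub_mul, Matrix.one_mul]
    rw [Matrix.mul_assoc, hG, Matrix.mul_one] at this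
    rw [this]
    abel
  have h1 : ‖G‖ ≤ 1 + 1 / 2 * ‖G‖ := by
    conv_lhs => rw [e]
    refine (norm_add_le _ _).trans (add_le_add ?_ ?_)
    · rwa [norm_transpose]
    · exact (norm_mul_le _ _).trans (mul_le_mul_of_nonneg_right hT (norm_nonneg _))
  linarith

theorem isUnit_of_gram_near_one {K T : Matrix (Fin r) (Fin r) ℝ} (hT : ‖T‖ ≤ 1 / 2)
    (h : Kᵀ * K = 1 - T) : IsUnit K := by
  have hu : IsUnit (Kᵀ * K) := by
    rw [h]
    exact isUnit_one_sub_of_norm_lt_one (by linarith)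
  rw [isUnit_iff_isUnit_det, det_mul] at hu
  rw [isUnit_iff_isUnit_det]
  exact isUnit_of_mul_isUnit_right hu

/-- Davis–Kahan: the principal eigenspaces of two nearby symmetric matrices are close. -/
theorem davis_kahan {A B : Matrix (Fin d) (Fin d) ℝ} {V W : Matrix (Fin d) (Fin r) ℝ} {a b : ℝ}
    (hV : OrthonormalCols V) (hAV : V * Vᵀ * A = A * (V * Vᵀ))
    (hAb : ∀ x, Vᵀ *ᵥ x = 0 → x ⬝ᵥ (A *ᵥ x) ≤ b * (x ⬝ᵥ x))
    (hBW : B * W = W * (Wᵀ * B * W)) (hW : OrthonormalCols W)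
    (hWa : ∀ x, a * (x ⬝ᵥ x) ≤ x ⬝ᵥ ((Wᵀ * B * W) *ᵥ x)) :
    (a - b) * ‖(1 - V * Vᵀ) * W‖ ≤ ‖B - A‖ := by
  have hPA : (1 - V * Vᵀ) * A = A * (1 - V * Vᵀ) := by
    rw [Matrix.sub_mul, hAV, Matrix.mul_sub, Matrix.one_mul, Matrix.mul_one]
  have hVP : Vᵀ * (1 - V * Vᵀ) = 0 := by
    rw [Matrix.mul_sub, Matrix.mul_one, ← Matrix.mul_assoc, hV, Matrix.one_mul, sub_self]
  -- The projection commutes with `A`, and `W (Wᵀ B W) = B W`; only the projected error survives.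
  have hsyl : A * ((1 - V * Vᵀ) * W) - (1 - V * Vᵀ) * W * (Wᵀ * B * W)
      = -((1 - V * Vᵀ) * (B - A) * W) := by
    rw [Matrix.mul_assoc (1 - V * Vᵀ) W, ← hBW, ← Matrix.mul_assoc, ← hPA, Matrix.mul_sub _ B A,
      Matrix.sub_mul _ _ W, ← Matrix.mul_assoc (1 - V * Vᵀ) B]
    abel
  refine (gap_mul_norm_le_of_sylvester hsyl (fun v => hAb _ ?_) hWa).trans ?_
  · rw [mulVec_mulVec, ← Matrix.mul_assoc, hVP, Matrix.zero_mul, zero_mulVec]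
  · rw [norm_neg]
    refine (l2_opNorm_mul _ _).trans ?_
    refine (mul_le_of_le_one_right (norm_nonneg _) (norm_le_one_of_orthonormalCols hW)).trans ?_
    exact (norm_mul_le _ _).trans
      (mul_le_of_le_one_left (norm_nonneg _) (norm_one_sub_mul_transpose_le hV))

/-- First-order expansion of an orthonormal frame `W` of an invariant subspace of `B`, which is
aligned with `V` up to an error `η`, around the frame `V` of an invariant subspace of `A`: the
linear part `X` solves a Sylvester equation with a quadratically small remainder `R`. -/
theorem exists_first_order_expansion {A B : Matrix (Fin d) (Fin d) ℝ}
    {V W : Matrix (Fin d) (Fin r) ℝ} {g η : ℝ} (hg : 0 < g) (hV : OrthonormalCols V)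
    (hAV : V * Vᵀ * A = A * (V * Vᵀ)) (hBW : B * W = W * (Wᵀ * B * W)) (hW : OrthonormalCols W)
    (hE : ‖B - A‖ ≤ g / 8) (ht : ‖(1 - V * Vᵀ) * W‖ ≤ 8 / 7 * (‖B - A‖ / g))
    (hη : ‖Vᵀ * W - 1‖ ≤ η) :
    ∃ X R : Matrix (Fin d) (Fin r) ℝ, Vᵀ * X = 0 ∧
      A * X - X * (Vᵀ * A * V) = R - (1 - V * Vᵀ) * (B - A) * V ∧
      ‖R‖ ≤ 7 * (‖B - A‖ ^ 2 / g) ∧ ‖W - V - X‖ ≤ 2 * η := by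
  set K := Vᵀ * W with hK
  set T := (1 - V * Vᵀ) * W with hT
  set Λ := Wᵀ * B * W with hΛ
  set E := B - A with hEdef
  have hK1 : ‖K‖ ≤ 1 := norm_transpose_mul_le_one hV hW
  have ht' : ‖T‖ ≤ 1 / 7 := by
    have : ‖E‖ / g ≤ 1 / 8 := by rw [div_le_iff₀ hg]; linarith
    linarith
  have hKK : Kᵀ * K = 1 - Tᵀ * T := by
    rw [hT, complement_gram hV, hW]
    abel
  have hTT : ‖Tᵀ * T‖ ≤ 1 / 2 := by
    rw [norm_transpose_mul_self]
    nlinarith [norm_nonneg T]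
  have hunit := (isUnit_iff_isUnit_det _).mp (isUnit_of_gram_near_one hTT hKK)
  obtain ⟨G, hKG, hGK⟩ : ∃ G, K * G = 1 ∧ G * K = 1 :=
    ⟨K⁻¹, mul_nonsing_inv _ hunit, nonsing_inv_mul _ hunit⟩
  have hG : ‖G‖ ≤ 2 := norm_le_two_of_inverse hKG hK1 hTT hKK
  have hPA : (1 - V * Vᵀ) * A = A * (1 - V * Vᵀ) := by
    rw [Matrix.sub_mul, hAV, Matrix.mul_sub, Matrix.one_mul, Matrix.mul_one]
  have hVP : Vᵀ * (1 - V * Vᵀ) = 0 := by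
    rw [Matrix.mul_sub, Matrix.mul_one, ← Matrix.mul_assoc, hV, Matrix.one_mul, sub_self]
  have hVA : Vᵀ * A = Vᵀ * A * V * Vᵀ := by
    have := congrArg (Vᵀ * ·) hAV
    simp only [← Matrix.mul_assoc] at this
    rw [hV, Matrix.one_mul] at this
    exact this
  have hBEA : B = A + E := by rw [hEdef]; abel
  have hAT : A * T = T * Λ - (1 - V * Vᵀ) * E * W := by
    have : T * Λ = (1 - V * Vᵀ) * (A + E) * W := by
      rw [hT, Matrix.mul_assoc, ← hBW, hBEA, Matrix.mul_assoc]
    rw [this, hT, ← Matrix.mul_assoc, ← hPA, Matrix.mul_add, Matrix.add_mul]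
    abel
  have hKΛ : K * Λ = Vᵀ * A * V * K + Vᵀ * E * W := by
    rw [hK, Matrix.mul_assoc, ← hBW, hBEA, Matrix.add_mul, Matrix.mul_add, ← Matrix.mul_assoc,
      ← Matrix.mul_assoc, ← Matrix.mul_assoc, ← hVA]
  -- Conjugation by `K` trades the node-dependent `Λ` for `Vᵀ A V`, up to a term linear in `E`. One
  -- common Sylvester operator results, which averaging requires.
  have hΛG : Λ * G = G * (Vᵀ * A * V) + G * (Vᵀ * E * W * G) := by
    calc Λ * G = G * (K * Λ) * G := by rw [← Matrix.mul_assoc, hGK, Matrix.one_mul]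
      _ = G * (Vᵀ * A * V * (K * G)) + G * (Vᵀ * E * W * G) := by
        rw [hKΛ, Matrix.mul_add, Matrix.add_mul]
        simp only [Matrix.mul_assoc]
      _ = _ := by rw [hKG, Matrix.mul_one]
  have hWG : W * G = V + T * G := by
    have : W = V * K + T := by
      rw [hT, hK, Matrix.sub_mul, Matrix.one_mul, Matrix.mul_assoc]
      abel
    conv_lhs => rw [this]
    rw [Matrix.add_mul, Matrix.mul_assoc, hKG, Matrix.mul_one]
  have hT0 := norm_nonneg T
  have hE0 := norm_nonneg E
  have hX : ‖T * G‖ ≤ 2 * ‖T‖ := by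
    refine (l2_opNorm_mul _ _).trans ?_
    nlinarith
  have hWG2 : ‖W * G‖ ≤ 2 :=
    (l2_opNorm_mul _ _).trans ((mul_le_of_le_one_left (norm_nonneg _)
      (norm_le_one_of_orthonormalCols hW)).trans hG)
  -- Each term of the remainder contains both `T` and `E`. The bounds below total `6 ‖T‖ ‖E‖ ≤ 48/7
  -- · ‖E‖² / g`, whence the constant 7.
  refine ⟨T * G, T * G * (Vᵀ * E * (W * G)) - (1 - V * Vᵀ) * E * (T * G), ?_, ?_, ?_, ?_⟩
  · rw [hT, ← Matrix.mul_assoc, ← Matrix.mul_assoc, hVP, Matrix.zero_mul, Matrix.zero_mul]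
  · have h1 : (1 - V * Vᵀ) * E * V = (1 - V * Vᵀ) * E * (W * G) - (1 - V * Vᵀ) * E * (T * G) := by
      rw [hWG, Matrix.mul_add]
      abel
    rw [h1, ← Matrix.mul_assoc A, hAT, Matrix.sub_mul, Matrix.mul_assoc T, hΛG, Matrix.mul_add]
    simp only [Matrix.mul_assoc]
    abel
  · have h1 : ‖T * G * (Vᵀ * E * (W * G))‖ ≤ 2 * ‖T‖ * (‖E‖ * 2) := by
      refine (l2_opNorm_mul _ _).trans (mul_le_mul hX ?_ (norm_nonneg _) (by positivity))
      refine (l2_opNorm_mul _ _).trans (mul_le_mul ?_ hWG2 (norm_nonneg _) (norm_nonneg _))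
      refine (l2_opNorm_mul _ _).trans (mul_le_of_le_one_left (norm_nonneg _) ?_)
      rw [norm_transpose]
      exact norm_le_one_of_orthonormalCols hV
    have h2 : ‖(1 - V * Vᵀ) * E * (T * G)‖ ≤ ‖E‖ * (2 * ‖T‖) := by
      refine (l2_opNorm_mul _ _).trans (mul_le_mul ?_ hX (norm_nonneg _) (norm_nonneg _))
      exact (norm_mul_le _ _).trans
        (mul_le_of_le_one_left (norm_nonneg _) (norm_one_sub_mul_transpose_le hV))
    have h3 : ‖T‖ * ‖E‖ ≤ 8 / 7 * (‖E‖ ^ 2 / g) := by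
      have := mul_le_mul_of_nonneg_right ht hE0
      calc ‖T‖ * ‖E‖ ≤ _ := this
        _ = _ := by ring
    have h4 : 0 ≤ ‖E‖ ^ 2 / g := by positivity
    have := norm_sub_le (T * G * (Vᵀ * E * (W * G))) ((1 - V * Vᵀ) * E * (T * G))
    linarith
  · have h1 : W - V - T * G = W * G * (K - 1) := by
      rw [Matrix.mul_sub, Matrix.mul_assoc W, hGK, Matrix.mul_one, Matrix.mul_one, hWG]
      abel
    rw [h1]
    exact (l2_opNorm_mul _ _).trans
      (mul_le_mul hWG2 hη (norm_nonneg _) zero_le_two)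

/-- A rotated basis of the principal eigenspace is invariant, and the compression of the matrix to
it is bounded below. -/
theorem SpansPrincipal.mul_orthogonal {B : Matrix (Fin d) (Fin d) ℝ} (hB : B.IsHermitian)
    (hr : 0 < r) (hrd : r < d) {Y : Matrix (Fin d) (Fin r) ℝ} (h : SpansPrincipal B Y)
    {Z : Matrix (Fin r) (Fin r) ℝ} (hZ : Z ∈ orthogonalGroup (Fin r) ℝ) :
    B * (Y * Z) = Y * Z * ((Y * Z)ᵀ * B * (Y * Z)) ∧
      ∀ x, sortedEigenvalue hB ⟨r - 1, by omega⟩ * (x ⬝ᵥ x)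
        ≤ x ⬝ᵥ (((Y * Z)ᵀ * B * (Y * Z)) *ᵥ x) := by
  obtain ⟨hcomm, hlow, -⟩ := h.spectral_bounds hB hr hrd
  have hZZ := (mem_orthogonalGroup_iff _ _).mp hZ
  have hZZ' := (mem_orthogonalGroup_iff' _ _).mp hZ
  have hY : Yᵀ * Y = 1 := h.1
  have e : (Y * Z)ᵀ * B * (Y * Z) = Zᵀ * (Yᵀ * B * Y) * Z := by
    rw [transpose_mul]
    simp only [Matrix.mul_assoc]
  refine ⟨?_, fun x => ?_⟩
  · calc B * (Y * Z) = B * (Y * Yᵀ) * Y * Z := by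
          simp only [Matrix.mul_assoc]
          rw [← Matrix.mul_assoc Yᵀ Y, hY, Matrix.one_mul]
      _ = Y * (Z * Zᵀ) * Yᵀ * B * Y * Z := by
          rw [← hcomm, hZZ, Matrix.mul_one]
      _ = _ := by
          rw [e]
          simp only [Matrix.mul_assoc]
  · have hx : x ⬝ᵥ x = (Z *ᵥ x) ⬝ᵥ (Z *ᵥ x) := by
      rw [dotProduct_mulVec_comm Z, mulVec_mulVec, hZZ', one_mulVec]
    rw [e, hx, ← mulVec_mulVec, ← mulVec_mulVec, dotProduct_mulVec_comm Zᵀ, transpose_transpose]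
    exact hlow _

/-- The expansion of one aligned response around the aligned basis of the reference matrix. -/
theorem exists_aligned_expansion {A B : Matrix (Fin d) (Fin d) ℝ} (hA : A.IsHermitian)
    (hB : B.IsHermitian) (hr : 0 < r) (hrd : r < d) (hg : 0 < eigengap hA hr hrd)
    (hE : ‖B - A‖ ≤ eigengap hA hr hrd / 8) {V Y U : Matrix (Fin d) (Fin r) ℝ}
    (hV : SpansPrincipal A V) (hY : SpansPrincipal B Y) (hU : OrthonormalCols U)
    (hVU : IsProcrustesSolution V U 1) {Z : Matrix (Fin r) (Fin r) ℝ}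
    (hZ : IsProcrustesSolution Y U Z) :
    ∃ X R : Matrix (Fin d) (Fin r) ℝ, Vᵀ * X = 0 ∧
      A * X - X * (Vᵀ * A * V) = R - (1 - V * Vᵀ) * (B - A) * V ∧
      ‖R‖ ≤ 7 * (‖B - A‖ ^ 2 / eigengap hA hr hrd) ∧
      ‖Y * Z - V - X‖ ≤ 8 * ‖(1 - V * Vᵀ) * U‖ ^ 2
        + 11 * (‖B - A‖ / eigengap hA hr hrd) ^ 2 := by
  obtain ⟨hcomm, -, hup⟩ := hV.spectral_bounds hA hr hrd
  obtain ⟨hinv, hlow⟩ := hY.mul_orthogonal hB hr hrd hZ.1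
  have hW := hY.1.mul_orthogonal hZ.1
  have hweyl := sortedEigenvalue_le_add_norm_sub hA hB ⟨r - 1, by omega⟩
  rw [norm_sub_rev] at hweyl
  have hdk := davis_kahan hV.1 hcomm hup hinv hW hlow
  set t := ‖(1 - V * Vᵀ) * (Y * Z)‖ with htdef
  have ht0 : 0 ≤ t := norm_nonneg _
  have ht : t ≤ 8 / 7 * (‖B - A‖ / eigengap hA hr hrd) := by
    rw [mul_div_assoc', le_div_iff₀ hg]
    -- Weyl's inequality costs at most one eighth of the gap; this is the source of the factor
    -- `8/7`.
    have hgap : 7 / 8 * eigengap hA hr hrd ≤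
        sortedEigenvalue hB ⟨r - 1, by omega⟩ - sortedEigenvalue hA ⟨r, hrd⟩ := by
      unfold eigengap at *
      linarith
    have := mul_le_mul_of_nonneg_right hgap ht0
    linarith
  obtain ⟨hs, hp⟩ := hVU.symm_and_nonneg hV.1
  obtain ⟨hs', hp'⟩ := hZ.symm_and_nonneg hY.1
  rw [Matrix.mul_one] at hs
  simp only [Matrix.mul_one] at hp
  have hη := norm_transpose_mul_sub_one_le hV.1 hW hU hs hp hs' hp'
  rw [← htdef] at hη
  obtain ⟨X, R, h1, h2, h3, h4⟩ :=
    exists_first_order_expansion hg hV.1 hcomm hinv hW hE ht hη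
  refine ⟨X, R, h1, h2, h3, h4.trans ?_⟩
  -- The total is `2 · 4 (N² + t²)` with `N` the distance from `V` to `U`, and `8 · (8/7)² < 11`.
  have := pow_le_pow_left₀ ht0 ht 2
  nlinarith [sq_nonneg (‖B - A‖ / eigengap hA hr hrd)]

end Perturbation

/-! ### Averaging the expansions. -/

section Average

variable {d r m : ℕ}

theorem CorruptionModel.orthonormalCols {α : ℝ} {bad : Finset (Fin m)}
    {B : Fin m → Matrix (Fin d) (Fin d) ℝ} {Y : Fin m → Matrix (Fin d) (Fin r) ℝ}
    (h : CorruptionModel α bad B Y) (i : Fin m) : OrthonormalCols (Y i) := by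
  by_cases hi : i ∈ bad
  · exact h.bad_response i hi
  · exact (h.good_response i hi).1

theorem norm_average_le {ι : Type*} (S : Finset ι) {n k : ℕ} (M : ι → Matrix (Fin n) (Fin k) ℝ)
    {f : ι → ℝ} (hf : ∀ i ∈ S, ‖M i‖ ≤ f i) :
    ‖(1 / (S.card : ℝ)) • ∑ i ∈ S, M i‖ ≤ 1 / (S.card : ℝ) * ∑ i ∈ S, f i := by
  rw [norm_smul, Real.norm_of_nonneg (by positivity)]
  exact mul_le_mul_of_nonneg_left (norm_sum_le_of_le S hf) (by positivity)

theorem average_sub_const {ι E : Type*} [AddCommGroup E] [Module ℝ E] {S : Finset ι}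
    (hS : S.Nonempty) (f : ι → E) (c : E) :
    (1 / (S.card : ℝ)) • ∑ i ∈ S, (f i - c) = (1 / (S.card : ℝ)) • ∑ i ∈ S, f i - c := by
  have : (S.card : ℝ) ≠ 0 := by exact_mod_cast hS.card_ne_zero
  rw [Finset.sum_sub_distrib, Finset.sum_const, smul_sub, ← Nat.cast_smul_eq_nsmul ℝ, smul_smul,
    one_div_mul_cancel this, one_smul]

/-- The Sylvester equations are summed before the lower bound is used, so the linear term involves
the norm of the mean error, not the mean of the norms. The constant 18 is 11 from the frame mismatch
plus 7 from the remainder. -/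
theorem norm_average_sub_le {A : Matrix (Fin d) (Fin d) ℝ} (hA : A.IsHermitian) (hr : 0 < r)
    (hrd : r < d) (hg : 0 < eigengap hA hr hrd) {B : Fin m → Matrix (Fin d) (Fin d) ℝ}
    {Y : Fin m → Matrix (Fin d) (Fin r) ℝ} {V U : Matrix (Fin d) (Fin r) ℝ}
    {Z : Fin m → Matrix (Fin r) (Fin r) ℝ} {S : Finset (Fin m)} (hS : S.Nonempty)
    (hV : SpansPrincipal A V) (hU : OrthonormalCols U) (hVU : IsProcrustesSolution V U 1)
    (hB : ∀ i ∈ S, (B i).IsHermitian) (hE : ∀ i ∈ S, ‖B i - A‖ ≤ eigengap hA hr hrd / 8)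
    (hY : ∀ i ∈ S, SpansPrincipal (B i) (Y i)) (hZ : ∀ i ∈ S, IsProcrustesSolution (Y i) U (Z i)) :
    ‖(1 / (S.card : ℝ)) • ∑ i ∈ S, Y i * Z i - V‖ ≤
      1 / (S.card : ℝ) * ∑ i ∈ S, (8 * ‖(1 - V * Vᵀ) * U‖ ^ 2
        + 18 * (‖B i - A‖ / eigengap hA hr hrd) ^ 2)
      + 1 / eigengap hA hr hrd * ‖(1 / (S.card : ℝ)) • ∑ i ∈ S, B i - A‖ := by
  set g := eigengap hA hr hrd with hgdef
  set c := 1 / (S.card : ℝ) with hc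
  set N := ‖(1 - V * Vᵀ) * U‖ with hN
  obtain ⟨-, hlow, hup⟩ := hV.spectral_bounds hA hr hrd
  -- The dummy pair `0` outside `S` makes the choice a total function of `i`.
  have hex : ∀ i, ∃ XR : Matrix (Fin d) (Fin r) ℝ × Matrix (Fin d) (Fin r) ℝ, i ∈ S →
      Vᵀ * XR.1 = 0 ∧ A * XR.1 - XR.1 * (Vᵀ * A * V) = XR.2 - (1 - V * Vᵀ) * (B i - A) * V ∧
      ‖XR.2‖ ≤ 7 * (‖B i - A‖ ^ 2 / g) ∧
      ‖Y i * Z i - V - XR.1‖ ≤ 8 * N ^ 2 + 11 * (‖B i - A‖ / g) ^ 2 := fun i => by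
    by_cases hi : i ∈ S
    · obtain ⟨X, R, h⟩ := exists_aligned_expansion hA (hB i hi) hr hrd hg (hE i hi) hV (hY i hi)
        hU hVU (hZ i hi)
      exact ⟨(X, R), fun _ => h⟩
    · exact ⟨0, fun h => absurd h hi⟩
  choose XR hXR using hex
  set X := c • ∑ i ∈ S, (XR i).1 with hX
  have hVX : Vᵀ * X = 0 := by
    rw [hX, Matrix.mul_smul, Matrix.mul_sum, Finset.sum_eq_zero (fun i hi => (hXR i hi).1),
      smul_zero]
  have hsyl : A * X - X * (Vᵀ * A * V)
      = c • ∑ i ∈ S, (XR i).2 - (1 - V * Vᵀ) * (c • ∑ i ∈ S, B i - A) * V := by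
    rw [hX, Matrix.mul_smul, Matrix.smul_mul, Matrix.mul_sum, Matrix.sum_mul, ← smul_sub,
      ← Finset.sum_sub_distrib, Finset.sum_congr rfl (fun i hi => (hXR i hi).2.1),
      Finset.sum_sub_distrib, smul_sub, ← Matrix.sum_mul, ← Matrix.mul_sum, ← Matrix.smul_mul,
      ← Matrix.mul_smul, average_sub_const hS]
  have hXn : g * ‖X‖ ≤ c * ∑ i ∈ S, 7 * (‖B i - A‖ ^ 2 / g) + ‖c • ∑ i ∈ S, B i - A‖ := by
    refine (gap_mul_norm_le_of_sylvester hsyl (fun v => hup _ ?_) hlow).trans ?_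
    · rw [mulVec_mulVec, hVX, zero_mulVec]
    · refine (norm_sub_le _ _).trans (add_le_add
        (norm_average_le S _ fun i hi => (hXR i hi).2.2.1) ?_)
      refine (l2_opNorm_mul _ _).trans ((mul_le_of_le_one_right (norm_nonneg _)
        (norm_le_one_of_orthonormalCols hV.1)).trans ?_)
      exact (norm_mul_le _ _).trans
        (mul_le_of_le_one_left (norm_nonneg _) (norm_one_sub_mul_transpose_le hV.1))
  have hXn' : ‖X‖ ≤ c * ∑ i ∈ S, 7 * (‖B i - A‖ / g) ^ 2 + 1 / g * ‖c • ∑ i ∈ S, B i - A‖ := by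
    have e : ∑ i ∈ S, 7 * (‖B i - A‖ ^ 2 / g) = g * ∑ i ∈ S, 7 * (‖B i - A‖ / g) ^ 2 := by
      rw [Finset.mul_sum]
      refine Finset.sum_congr rfl fun i _ => ?_
      field_simp
    refine le_of_mul_le_mul_left (hXn.trans_eq ?_) hg
    rw [mul_add, ← mul_assoc g (1 / g), mul_one_div_cancel hg.ne', one_mul, mul_left_comm g c, e]
  have hdecomp : c • ∑ i ∈ S, Y i * Z i - V = c • ∑ i ∈ S, (Y i * Z i - V - (XR i).1) + X := by
    rw [hX, Finset.sum_sub_distrib, smul_sub, average_sub_const hS]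
    abel
  have hmain := norm_average_le S _ fun i hi => (hXR i hi).2.2.2
  rw [← hc] at hmain
  have hsum : ∑ i ∈ S, (8 * N ^ 2 + 18 * (‖B i - A‖ / g) ^ 2)
      = ∑ i ∈ S, (8 * N ^ 2 + 11 * (‖B i - A‖ / g) ^ 2) + ∑ i ∈ S, 7 * (‖B i - A‖ / g) ^ 2 := by
    rw [← Finset.sum_add_distrib]
    exact Finset.sum_congr rfl fun i _ => by ring
  rw [hdecomp, hsum, mul_add]
  refine (norm_add_le _ _).trans ?_
  linarith

theorem specNorm_nonneg {n k : ℕ} (M : Matrix (Fin n) (Fin k) ℝ) : 0 ≤ specNorm M :=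
  norm_nonneg M

/-- From `δ ≤ 2 a` one gets `ε² ≤ 4 a² ε² / δ²`, so the maximum pays for both terms with `8 · 4 + 18
= 50`. -/
theorem add_sq_le_mul_max {ε e a g δ : ℝ} (hδ : 0 < δ) (hδg : δ ≤ g) (hga : g ≤ 2 * a) :
    8 * ε ^ 2 + 18 * (e / g) ^ 2 ≤ 50 * (1 / δ ^ 2 * max (e ^ 2) (a ^ 2 * ε ^ 2)) := by
  have h1 : (e / g) ^ 2 ≤ e ^ 2 / δ ^ 2 := by
    rw [div_pow]
    exact div_le_div_of_nonneg_left (sq_nonneg _) (by positivity)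
      (pow_le_pow_left₀ hδ.le hδg 2)
  have h2 : ε ^ 2 ≤ 4 * (a ^ 2 * ε ^ 2 / δ ^ 2) := by
    rw [mul_div_assoc', le_div_iff₀ (by positivity)]
    have := pow_le_pow_left₀ hδ.le (hδg.trans hga) 2
    have := mul_le_mul_of_nonneg_left this (sq_nonneg ε)
    linarith
  have h3 : e ^ 2 / δ ^ 2 ≤ max (e ^ 2) (a ^ 2 * ε ^ 2) / δ ^ 2 :=
    div_le_div_of_nonneg_right (le_max_left _ _) (by positivity)
  have h4 : a ^ 2 * ε ^ 2 / δ ^ 2 ≤ max (e ^ 2) (a ^ 2 * ε ^ 2) / δ ^ 2 :=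
    div_le_div_of_nonneg_right (le_max_right _ _) (by positivity)
  rw [one_div_mul_eq_div]
  linarith

end Average

end DistributedEigenspace

/-! ### The theorem with an explicit constant. -/

theorem proposition2 :
    ∃ C : ℝ, 0 < C ∧
      ∀ (d r m : ℕ) (hr : 0 < r) (hrd : r < d)
        (A : Matrix (Fin d) (Fin d) ℝ) (hA : A.IsHermitian)
        (δ : ℝ), 0 < δ → δ ≤ eigengap hA hr hrd →
      ∀ (α : ℝ) (bad : Finset (Fin m))
        (B : Fin m → Matrix (Fin d) (Fin d) ℝ) (Vhat : Fin m → Matrix (Fin d) (Fin r) ℝ),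
        CorruptionModel α bad B Vhat →
        (∀ i ∉ bad, specNorm (B i - A) ≤ eigengap hA hr hrd / 8) →
      ∀ Vref : Matrix (Fin d) (Fin r) ℝ, IsRobustReference Vhat Vref →
      -- the basis `V` of the principal eigenspace of `A` is the one aligned with `Vref`
      ∀ V : Matrix (Fin d) (Fin r) ℝ, SpansPrincipal A V → IsProcrustesSolution V Vref 1 →
      ∀ ε : ℝ, subspaceDist V Vref = ε → ε < eigengap hA hr hrd / 8 →
      ∀ S : Finset (Fin m), S.Nonempty → (∀ i ∈ S, i ∉ bad) →
      ∀ Z : Fin m → Matrix (Fin r) (Fin r) ℝ,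
        (∀ i ∈ S, IsProcrustesSolution (Vhat i) Vref (Z i)) →
        specNorm (((1 / (S.card : ℝ)) • ∑ i ∈ S, Vhat i * Z i) - V) ≤
          C * (1 / (δ ^ 2 * (S.card : ℝ)) *
                ∑ i ∈ S, max (specNorm (B i - A) ^ 2) (specNorm A ^ 2 * ε ^ 2)
              + 1 / δ * specNorm (((1 / (S.card : ℝ)) • ∑ i ∈ S, B i) - A)) := by
  -- The quadratic term dictates 50; the linear term needs only the constant 1.
  refine ⟨50, by norm_num, ?_⟩
  intro d r m hr hrd A hA δ hδ hδg α bad B Vhat hmodel hE Vref href V hV hVref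
    ε hε _ S hS hgood Z hZ
  have hg : 0 < eigengap hA hr hrd := hδ.trans_le hδg
  have hU : OrthonormalCols Vref := by
    obtain ⟨i, -, rfl⟩ := href
    exact hmodel.orthonormalCols i
  subst hε
  refine (norm_average_sub_le hA hr hrd hg hS hV hU hVref
    (fun i hi => hmodel.good_symm i (hgood i hi)) (fun i hi => hE i (hgood i hi))
    (fun i hi => hmodel.good_response i (hgood i hi)) hZ).trans ?_
  rw [mul_add]
  refine add_le_add ?_ ?_
  · have h1 := Finset.sum_le_sum fun i (_ : i ∈ S) =>
      add_sq_le_mul_max (ε := subspaceDist V Vref) (e := specNorm (B i - A)) hδ hδg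
        (eigengap_le_two_mul_norm hA hr hrd)
    rw [← Finset.mul_sum, ← Finset.mul_sum] at h1
    have hc : (0 : ℝ) ≤ 1 / (S.card : ℝ) := by positivity
    refine (mul_le_mul_of_nonneg_left h1 hc).trans_eq ?_
    rw [← one_div_mul_one_div]
    simp only [specNorm]
    ring
  · have h1 : 1 / eigengap hA hr hrd ≤ 1 / δ := one_div_le_one_div_of_le hδ hδg
    have h2 : 0 ≤ specNorm (((1 / (S.card : ℝ)) • ∑ i ∈ S, B i) - A) := specNorm_nonneg _
    have h3 := mul_le_mul_of_nonneg_right h1 h2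
    have h4 : 0 ≤ 1 / δ * specNorm (((1 / (S.card : ℝ)) • ∑ i ∈ S, B i) - A) := by positivity
    exact h3.trans (by linarith)
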